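/- Let $(P,d,\mu)$ be a metric space with a $\sigma$-finite, non-atomic, Borel regular measure $\mu$ such that every ball has finite positive measure ($\mu$ is not assumed to be doubling). "Measurable" means $\mu$-measurable, functions are defined everywhere with values in $[-\infty,\infty]$, and for such a function $f$ and $\sigma\ge 0$ put $\{|f|>\sigma\}=\{x\in P: |f(x)|>\sigma\}$. Let $X$ be a quasi-Banach function lattice over $(P,\mu)$ with continuous quasi-norm, i.e. $X=\{f \text{ measurable}: \|f\|_X<\infty\}$, where $\|\cdot\|_X$ maps measurable functions to $[0,\infty]$ and, for some constant $c\ge 1$: $\|f\|_X=0$ iff $f=0$ a.e.; $\|af\|_X=|a|\,\|f\|_X$ for $a\in\mathbb R$; $\|f+g\|_X\le c(\|f\|_X+\|g\|_X)$; $|f|\le|g|$ a.e. implies $\|f\|_X\le\|g\|_X$; $\|\sum_{n\ge1} f_n\|_X\le\sum_{n\ge1}c^n\|f_n\|_X$ whenever $f_n\ge0$; and $\|f_n-f\|_X\to0$ implies $\|f_n\|_X\to\|f\|_X$. Assume that the quasi-norm is absolutely continuous: for every $f\in X$, $\|f\chi_{E_n}\|_X\to0$ whenever $E_1\supset E_2\supset\cdots$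 are measurable sets with $\mu(\bigcap_n E_n)=0$. A Borel function $g:P\to[0,\infty]$ is an upper gradient of $u:P\to[-\infty,\infty]$ if $|u(\gamma(0))-u(\gamma(l))|\le\int_0^{l} g(\gamma(t))\,dt$ for every non-constant rectifiable curve $\gamma:[0,l]\to P$ parametrized by arc length, where $|(\pm\infty)-(\pm\infty)|=\infty$. For measurable $u$ put $\|u\|_{N^1X}=\|u\|_X+\inf_g\|g\|_X$, the infimum being over all upper gradients $g$ of $u$, and let $N^1X=\{u \text{ measurable}:\|u\|_{N^1X}<\infty\}$. A measurable $h:P\to[0,\infty]$ is a Hajłasz gradient of $u$ if there is a set $E$ with $\mu(E)=0$ such that $|u(x)-u(y)|\le d(x,y)(h(x)+h(y))$ for all $x,y\in P\setminus E$. For $q>0$, $L^q_{\mathrm{fm}}$ is the set of measurable $f$ with $\int_E|f|^q\,d\mu<\infty$ for every measurable $E$ with $\mu(E)<\infty$. **Theorem.** Suppose that $u\in N^1X$ has a Hajłasz gradient $h$ such that $\|\sigma\chi_{\{h>\sigma\}}\|_X\to0$ as $\sigma\to\infty$, or such that $h\in X$. Then for every $\varepsilon>0$ there are a Lipschitz function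 $u_\varepsilon:P\to\mathbb R$ with $u_\varepsilon\in N^1X$ and a measurable set $E_\varepsilon\subset P$ such that $$\|u-u_\varepsilon\|_{N^1X}<\varepsilon,\qquad u=u_\varepsilon\ \text{ on } P\setminus E_\varepsilon,\qquad\text{and}\qquad \mu\Bigl(\bigcap_{\varepsilon>0}E_\varepsilon\Bigr)=0.$$ Moreover, these can be chosen so that $\mu(E_\varepsilon)<\varepsilon$ for every $\varepsilon>0$, provided that one of the following holds: (a) $\{h>\sigma\}$ and $\{|u|>\sigma\}$ have finite measure for some $\sigma>0$; (b) $u,h\in L^q_{\mathrm{fm}}$ for some $q>0$; (c) $X\subset L^q_{\mathrm{fm}}$ for some $q>0$. -/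

import Mathlib

open MeasureTheory Filter Topology Set
open scoped ENNReal NNReal

/-- A quasi-Banach function lattice over `(P, μ)` with continuous quasi-norm. `nrm u` is the
quasi-norm of `u`; it matters only for `μ`-measurable (that is, a.e.-measurable with respect to
the Borel `σ`-algebra) extended real-valued functions defined everywhere. The space itself is the
set of `u` with `nrm u < ∞`, see `QBFL.Mem`. -/
structure QBFL {P : Type*} [MeasurableSpace P] (μ : Measure P) where
  /-- the quasi-norm -/
  nrm : (P → EReal) → ℝ≥0∞
  /-- the modulus of concavity -/
  conc : ℝ≥0
  one_le_conc : 1 ≤ conc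
  nrm_eq_zero : ∀ u : P → EReal, AEMeasurable u μ → (nrm u = 0 ↔ u =ᵐ[μ] 0)
  nrm_smul : ∀ (a : ℝ) (u : P → EReal), AEMeasurable u μ →
    nrm (fun x => (a : EReal) * u x) = ENNReal.ofReal |a| * nrm u
  nrm_add_le : ∀ u v : P → EReal, AEMeasurable u μ → AEMeasurable v μ →
    nrm (fun x => u x + v x) ≤ conc * (nrm u + nrm v)
  /-- the lattice property -/
  nrm_mono : ∀ u v : P → EReal, AEMeasurable u μ → AEMeasurable v μ →
    (∀ᵐ x ∂μ, (u x).abs ≤ (v x).abs) → nrm u ≤ nrm v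
  /-- the Riesz--Fischer property; the sequence is indexed from `0` -/
  riesz_fischer : ∀ u : ℕ → P → ℝ≥0∞, (∀ n, AEMeasurable (u n) μ) →
    nrm (fun x => ((∑' n, u n x : ℝ≥0∞) : EReal)) ≤
      ∑' n, (conc : ℝ≥0∞) ^ (n + 1) * nrm (fun x => (u n x : EReal))
  /-- continuity of the quasi-norm -/
  nrm_continuous : ∀ (u : ℕ → P → EReal) (v : P → EReal),
    (∀ n, AEMeasurable (u n) μ) → AEMeasurable v μ →
    Tendsto (fun n => nrm (fun x => u n x - v x)) atTop (𝓝 0) →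
    Tendsto (fun n => nrm (u n)) atTop (𝓝 (nrm v))

namespace QBFL

variable {P : Type*} [MeasurableSpace P] {μ : Measure P}

/-- `u ∈ X`. -/
def Mem (X : QBFL μ) (u : P → EReal) : Prop :=
  AEMeasurable u μ ∧ X.nrm u < ⊤

/-- The quasi-norm of `X` is absolutely continuous. -/
def IsAbsCont (X : QBFL μ) : Prop :=
  ∀ u : P → EReal, X.Mem u → ∀ E : ℕ → Set P, Antitone E →
    (∀ n, NullMeasurableSet (E n) μ) → μ (⋂ n, E n) = 0 →
    Tendsto (fun n => X.nrm ((E n).indicator u)) atTop (𝓝 0)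

end QBFL

/-- The Borel function `g` is an upper gradient of `u`. The curves are the non-constant
rectifiable ones, `γ : [0, l] → P` with `l > 0` parametrized by arc length. In `EReal`,
`(a - b).abs = ⊤` as soon as `a` or `b` is infinite, including `a = b = ±∞`. -/
def IsUpperGradient {P : Type*} [MetricSpace P] [MeasurableSpace P]
    (g : P → ℝ≥0∞) (u : P → EReal) : Prop :=
  Measurable g ∧ ∀ (l : ℝ) (γ : ℝ → P), 0 < l → HasUnitSpeedOn γ (Icc 0 l) →
    (u (γ 0) - u (γ l)).abs ≤ ∫⁻ t in Icc 0 l, g (γ t)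

/-- The Newtonian quasi-norm: the quasi-norm of `u` in `X` plus the infimum of those of its upper
gradients. -/
noncomputable def newtonNorm {P : Type*} [MetricSpace P] [MeasurableSpace P] {μ : Measure P}
    (X : QBFL μ) (u : P → EReal) : ℝ≥0∞ :=
  X.nrm u + ⨅ (g : P → ℝ≥0∞) (_ : IsUpperGradient g u), X.nrm (fun x => (g x : EReal))

/-- `u` belongs to the Newtonian space based on `X`. -/
def MemNewton {P : Type*} [MetricSpace P] [MeasurableSpace P] {μ : Measure P}
    (X : QBFL μ) (u : P → EReal) : Prop :=
  AEMeasurable u μ ∧ newtonNorm X u < ⊤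

/-- `h` is a Hajłasz gradient of `u`. -/
def IsHajlaszGradient {P : Type*} [MetricSpace P] [MeasurableSpace P] (μ : Measure P)
    (h : P → ℝ≥0∞) (u : P → EReal) : Prop :=
  AEMeasurable h μ ∧ ∃ E : Set P, μ E = 0 ∧ ∀ x ∉ E, ∀ y ∉ E,
    (u x - u y).abs ≤ edist x y * (h x + h y)

/-- The superlevel set `{|u| > σ}`. -/
def supLevel {P : Type*} (u : P → EReal) (σ : ℝ≥0) : Set P :=
  {x | (σ : ℝ≥0∞) < (u x).abs}

/-- `f` belongs to `L^q` on every measurable set of finite measure. -/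
def MemLqFin {P : Type*} [MeasurableSpace P] (μ : Measure P) (q : ℝ) (f : P → EReal) : Prop :=
  AEMeasurable f μ ∧ ∀ E : Set P, NullMeasurableSet E μ → μ E < ⊤ →
    ∫⁻ x in E, (f x).abs ^ q ∂μ < ⊤

/-- The measure `μ` is non-atomic: every measurable set of positive measure has a measurable
subset of strictly smaller positive measure. -/
def IsNonatomic {P : Type*} [MeasurableSpace P] (μ : Measure P) : Prop :=
  ∀ A : Set P, MeasurableSet A → 0 < μ A → ∃ B ⊆ A, MeasurableSet B ∧ 0 < μ B ∧ μ B < μ A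

/-! Let `A n` be the set where `|u| > n` or `h > n`, together with a null set. Off `A n` the
function `u` is `2n`-Lipschitz and bounded by `n`, so it extends to a Lipschitz function `v n` on
`P` with `|v n| ≤ n`. Then `u - v n` lives on `A n`, where it is at most `|u| + n`.

The point is that, for an upper gradient `g` of `u`, the function `(g + 2n)χ_{A n}` controls `u - v
n` along every curve on which `g` is integrable: such a curve contributes only before its first and
after its last visit to the complement of `A n` (`ofReal_abs_sub_le_lintegral_indicator`). Adding `δ
g` with a small `δ > 0` disposes of the remaining curves (`IsUpperGradient.sub_lipschitz`).

Since `n χ_{A n} ≤ |u| χ_{A n} + n χ_{h > n}` a.e., all terms tend to zero: those with `|u|` and `g`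
by absolute continuity, because the `A n` decrease to a null set, and the last one by the assumption
on `h` (if `h ∈ X`, again by absolute continuity).

For small exceptional sets it suffices that some `A n` has finite measure. Under (b), infinite
superlevel sets would contain small pieces whose union has finite measure but carries an infinite
integral; this is where non-atomicity enters. Under (c), a Riesz–Fischer sum of truncations of `h`
gives an element of `X` that reduces the claim to the same argument. -/

/-! ### Upper gradients along arc-length curves -/

theorem HasUnitSpeedOn.comp_add_right {P : Type*} [PseudoEMetricSpace P] {γ : ℝ → P} {l s t : ℝ}
    (hγ : HasUnitSpeedOn γ (Icc 0 l)) (hs : 0 ≤ s) (ht : t ≤ l) :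
    HasUnitSpeedOn (fun τ => γ (τ + s)) (Icc 0 (t - s)) := by
  intro x hx y hy
  have hφ : MonotoneOn (fun τ : ℝ => τ + s) (Icc 0 (t - s)) :=
    fun a _ b _ hab => by simpa using hab
  have hI : (fun τ : ℝ => τ + s) '' Icc 0 (t - s) = Icc s t := by simp
  have h1 := eVariationOn.comp_inter_Icc_eq_of_monotoneOn γ (fun τ : ℝ => τ + s) hφ hx hy
  rw [hI] at h1
  have hx' : x + s ∈ Icc 0 l := ⟨by linarith [hx.1], by linarith [hx.2]⟩
  have hy' : y + s ∈ Icc 0 l := ⟨by linarith [hy.1], by linarith [hy.2]⟩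
  have h2 := hγ hx' hy'
  have h3 : Icc s t ∩ Icc (x + s) (y + s) = Icc 0 l ∩ Icc (x + s) (y + s) := by
    ext z
    simp only [mem_inter_iff, mem_Icc] at *
    constructor <;> rintro ⟨⟨_, _⟩, _, _⟩ <;> refine ⟨⟨?_, ?_⟩, ?_, ?_⟩ <;> linarith [hx.1, hy.2]
  rw [h3, h2] at h1
  rw [show y - x = y + s - (x + s) by ring]
  exact h1

theorem HasUnitSpeedOn.dist_le {P : Type*} [PseudoMetricSpace P] {γ : ℝ → P} {l s t : ℝ}
    (hγ : HasUnitSpeedOn γ (Icc 0 l)) (hs : 0 ≤ s) (hst : s ≤ t) (ht : t ≤ l) :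
    dist (γ s) (γ t) ≤ t - s := by
  have hs' : s ∈ Icc 0 l := ⟨hs, hst.trans ht⟩
  have ht' : t ∈ Icc 0 l := ⟨hs.trans hst, ht⟩
  have h1 : edist (γ s) (γ t) ≤ ENNReal.ofReal ((1 : ℝ≥0) * (t - s)) := by
    rw [← hγ hs' ht']
    exact eVariationOn.edist_le γ ⟨hs', left_mem_Icc.2 hst⟩ ⟨ht', right_mem_Icc.2 hst⟩
  rw [edist_dist] at h1
  have := (ENNReal.ofReal_le_ofReal_iff (by simpa using hst)).1 h1
  simpa using this

/-- The upper gradient inequality holds on every subcurve. -/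
theorem IsUpperGradient.abs_sub_le {P : Type*} [MetricSpace P] [MeasurableSpace P]
    {g : P → ℝ≥0∞} {u : P → EReal} (hg : IsUpperGradient g u) {γ : ℝ → P} {l s t : ℝ}
    (hγ : HasUnitSpeedOn γ (Icc 0 l)) (hs : 0 ≤ s) (hst : s < t) (ht : t ≤ l) :
    (u (γ s) - u (γ t)).abs ≤ ∫⁻ τ in Icc s t, g (γ τ) := by
  have h1 := hg.2 (t - s) (fun τ => γ (τ + s)) (by linarith) (hγ.comp_add_right hs ht)
  simp only [zero_add, sub_add_cancel] at h1
  refine h1.trans (le_of_eq ?_)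
  have h2 := (measurePreserving_add_right (volume : Measure ℝ) s).setLIntegral_comp_preimage_emb
    (measurableEmbedding_addRight s) (fun τ => g (γ τ)) (Icc s t)
  rw [← h2]
  simp

/-- A function on `[0, l]` whose oscillation is controlled by the integral of `F` changes only by
what `F` accumulates on a set off which the function vanishes. -/
theorem ofReal_abs_sub_le_lintegral_indicator {l : ℝ} (hl : 0 ≤ l) {F : ℝ → ℝ≥0∞}
    (hF : ∫⁻ t in Icc 0 l, F t ≠ ⊤) {w : ℝ → ℝ}
    (hw : ∀ s t, 0 ≤ s → s ≤ t → t ≤ l → ENNReal.ofReal |w s - w t| ≤ ∫⁻ τ in Icc s t, F τ)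
    {B : Set ℝ} (hB : ∀ t ∈ Icc 0 l, t ∉ B → w t = 0) :
    ENNReal.ofReal |w 0 - w l| ≤ ∫⁻ t in Icc 0 l, B.indicator F t := by
  by_cases hZ : ∀ t ∈ Icc 0 l, t ∈ B
  · refine (hw 0 l le_rfl hl le_rfl).trans (le_of_eq ?_)
    exact setLIntegral_congr_fun measurableSet_Icc fun t ht => by simp [hZ t ht]
  push Not at hZ
  set Z : Set ℝ := {t | t ∈ Icc 0 l ∧ t ∉ B} with hZdef
  have hne : Z.Nonempty := hZ
  have hbb : BddBelow Z := ⟨0, fun t ht => ht.1.1⟩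
  have hba : BddAbove Z := ⟨l, fun t ht => ht.1.2⟩
  -- The zeros of `w` in `Z` accumulate at both `a` and `b`, or attain them, so the oscillation over
  -- `[a, b]` is irrelevant, while `[0, a)` and `(b, l]` lie in `B`.
  set a := sInf Z
  set b := sSup Z
  have ha0 : 0 ≤ a := le_csInf hne fun t ht => ht.1.1
  have hbl : b ≤ l := csSup_le hne fun t ht => ht.1.2
  have hab : a ≤ b := csInf_le_csSup hne hbb hba
  have key : ENNReal.ofReal |w 0| ≤ ∫⁻ τ in Icc 0 a, F τ ∧
      ENNReal.ofReal |w l| ≤ ∫⁻ τ in Icc b l, F τ := by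
    -- Absolute continuity of the integral: `a` and `b` need not belong to `Z`, so nearby points of
    -- `Z` are used at the cost of an integral over a short interval.
    have small : ∀ ε : ℝ≥0, 0 < ε → ∃ δ : ℝ, 0 < δ ∧ ∀ s t, 0 ≤ s → t ≤ l → t - s < δ →
        ∫⁻ τ in Icc s t, F τ ≤ ε := by
      intro ε hε
      obtain ⟨δ, hδ, h⟩ := exists_pos_setLIntegral_lt_of_measure_lt hF
        (ENNReal.coe_ne_zero.2 hε.ne')
      obtain ⟨δ', h0, h1⟩ := ENNReal.lt_iff_exists_nnreal_btwn.1 hδ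
      refine ⟨δ', by exact_mod_cast h0, fun s t hs ht hst => ?_⟩
      have h2 := (h (Icc s t) (lt_of_le_of_lt ?_ h1)).le
      · rwa [Measure.restrict_restrict measurableSet_Icc,
          inter_eq_self_of_subset_left (Icc_subset_Icc hs ht)] at h2
      · refine (Measure.restrict_apply_le _ _).trans ?_
        rw [Real.volume_Icc]
        exact ENNReal.ofReal_le_of_le_toReal (by simpa using hst.le)
    constructor
    · refine ENNReal.le_of_forall_pos_le_add fun ε hε _ => ?_
      obtain ⟨δ, hδ, h⟩ := small ε hε
      obtain ⟨t, ht, hta⟩ := exists_lt_of_csInf_lt hne (show sInf Z < a + δ by linarith)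
      have hat : a ≤ t := csInf_le hbb ht
      have h1 := hw 0 t le_rfl ht.1.1 ht.1.2
      rw [hB t ht.1 ht.2, sub_zero] at h1
      refine h1.trans ?_
      rw [← Icc_union_Icc_eq_Icc ha0 hat]
      exact (lintegral_union_le _ _ _).trans
        (add_le_add le_rfl (h a t ha0 ht.1.2 (by linarith)))
    · refine ENNReal.le_of_forall_pos_le_add fun ε hε _ => ?_
      obtain ⟨δ, hδ, h⟩ := small ε hε
      obtain ⟨t, ht, htb⟩ := exists_lt_of_lt_csSup hne (show b - δ < sSup Z by linarith)
      have hbt : t ≤ b := le_csSup hba ht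
      have h1 := hw t l ht.1.1 ht.1.2 le_rfl
      rw [hB t ht.1 ht.2, zero_sub, abs_neg] at h1
      refine h1.trans ?_
      rw [← Icc_union_Icc_eq_Icc hbt hbl, union_comm]
      exact (lintegral_union_le _ _ _).trans
        (add_le_add le_rfl (h t b ht.1.1 hbl (by linarith)))
  have h1 : ∫⁻ τ in Icc 0 a, F τ = ∫⁻ τ in Ico 0 a, B.indicator F τ := by
    rw [setLIntegral_congr Ico_ae_eq_Icc.symm]
    refine setLIntegral_congr_fun measurableSet_Ico fun t ht => ?_
    have : t ∈ B := by
      by_contra hc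
      exact absurd (csInf_le hbb (show t ∈ Z from ⟨⟨ht.1, by linarith [ht.2]⟩, hc⟩))
        (not_le.2 ht.2)
    simp [this]
  have h2 : ∫⁻ τ in Icc b l, F τ = ∫⁻ τ in Ioc b l, B.indicator F τ := by
    rw [setLIntegral_congr Ioc_ae_eq_Icc.symm]
    refine setLIntegral_congr_fun measurableSet_Ioc fun t ht => ?_
    have : t ∈ B := by
      by_contra hc
      exact absurd (le_csSup hba (show t ∈ Z from ⟨⟨by linarith [ht.1], ht.2⟩, hc⟩))
        (not_le.2 ht.1)
    simp [this]
  calc ENNReal.ofReal |w 0 - w l| ≤ ENNReal.ofReal (|w 0| + |w l|) :=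
        ENNReal.ofReal_le_ofReal (abs_sub _ _)
    _ = ENNReal.ofReal |w 0| + ENNReal.ofReal |w l| :=
        ENNReal.ofReal_add (abs_nonneg _) (abs_nonneg _)
    _ ≤ (∫⁻ τ in Ico 0 a, B.indicator F τ) + ∫⁻ τ in Ioc b l, B.indicator F τ :=
        add_le_add (key.1.trans_eq h1) (key.2.trans_eq h2)
    _ = ∫⁻ τ in Ico 0 a ∪ Ioc b l, B.indicator F τ := by
        rw [lintegral_union measurableSet_Ioc]
        exact Set.disjoint_left.2 fun t ht ht' => by linarith [ht.2, ht'.1]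
    _ ≤ ∫⁻ t in Icc 0 l, B.indicator F t := by
        refine lintegral_mono_set (union_subset ?_ ?_)
        · exact fun t ht => ⟨ht.1, by linarith [ht.2]⟩
        · exact fun t ht => ⟨by linarith [ht.1], ht.2⟩

theorem EReal.exists_coe_of_abs_sub_lt_top {a b : EReal} (h : (a - b).abs < ⊤) :
    ∃ r s : ℝ, a = r ∧ b = s := by
  induction a <;> induction b <;> simp_all

theorem EReal.abs_coe_sub_coe (a b : ℝ) :
    ((a : EReal) - (b : EReal)).abs = ENNReal.ofReal |a - b| := by
  rw [← EReal.coe_sub, EReal.abs_def]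

/-- Along a curve on which an upper gradient of `u` is integrable, `u` is finite. -/
theorem IsUpperGradient.exists_real {P : Type*} [MetricSpace P] [MeasurableSpace P]
    {g : P → ℝ≥0∞} {u : P → EReal} (hg : IsUpperGradient g u) {γ : ℝ → P} {l : ℝ} (hl : 0 < l)
    (hγ : HasUnitSpeedOn γ (Icc 0 l)) (hfin : ∫⁻ t in Icc 0 l, g (γ t) ≠ ⊤) :
    ∃ U : ℝ → ℝ, ∀ t ∈ Icc 0 l, u (γ t) = (U t : EReal) := by
  refine ⟨fun t => (u (γ t)).toReal, fun t ht => ?_⟩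
  have : ∃ r : ℝ, u (γ t) = r := by
    rcases ht.1.eq_or_lt with h0 | h0
    · have h1 := (hg.abs_sub_le hγ le_rfl hl le_rfl).trans_lt hfin.lt_top
      obtain ⟨r, s, hr, -⟩ := EReal.exists_coe_of_abs_sub_lt_top h1
      exact ⟨r, h0 ▸ hr⟩
    · have h1 := (hg.abs_sub_le hγ le_rfl h0 ht.2).trans
        (lintegral_mono_set (Icc_subset_Icc_right ht.2))
      obtain ⟨r, s, -, hr⟩ := EReal.exists_coe_of_abs_sub_lt_top (h1.trans_lt hfin.lt_top)
      exact ⟨s, hr⟩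
  obtain ⟨r, hr⟩ := this
  simp [hr]

/-- If `u` agrees with a `K`-Lipschitz function `v` off the Borel set `A`, then the restriction
of `g + K` to `A` is, up to a small multiple of `g`, an upper gradient of `u - v`. -/
theorem IsUpperGradient.sub_lipschitz {P : Type*} [MetricSpace P] [MeasurableSpace P]
    {g : P → ℝ≥0∞} {u : P → EReal} (hg : IsUpperGradient g u) {v : P → ℝ} {K : ℝ≥0}
    (hv : LipschitzWith K v) {A : Set P} (hA : MeasurableSet A)
    (huv : ∀ x ∉ A, u x = (v x : EReal)) {δ : ℝ≥0} (hδ : δ ≠ 0) :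
    IsUpperGradient (fun x => A.indicator (fun y => g y + K) x + δ * g x)
      (fun x => u x - (v x : EReal)) := by
  refine ⟨((hg.1.add_const _).indicator hA).add (hg.1.const_mul _), fun l γ hl hγ => ?_⟩
  -- If `g` is not integrable along the curve, the term `δ * g` already makes the right-hand side
  -- infinite. Otherwise `u` is finite on the curve and real arithmetic applies.
  by_cases hfin : ∫⁻ t in Icc 0 l, g (γ t) = ⊤
  · refine le_trans le_top ?_
    rw [← ENNReal.mul_top (ENNReal.coe_ne_zero.2 hδ), ← hfin]
    refine (lintegral_const_mul_le _ _).trans (lintegral_mono fun t => le_add_self)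
  obtain ⟨U, hU⟩ := hg.exists_real hl hγ hfin
  have h0 : (0 : ℝ) ∈ Icc 0 l := ⟨le_rfl, hl.le⟩
  have hl' : l ∈ Icc 0 l := ⟨hl.le, le_rfl⟩
  have hmain := ofReal_abs_sub_le_lintegral_indicator hl.le (F := fun t => g (γ t) + K)
    (w := fun t => U t - v (γ t)) (B := γ ⁻¹' A) ?_ ?_ ?_
  · simp only [hU 0 h0, hU l hl', ← EReal.coe_sub, EReal.abs_def]
    refine hmain.trans (lintegral_mono fun t => ?_)
    exact le_self_add
  · rw [lintegral_add_right _ measurable_const]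
    simp [hfin, ENNReal.mul_eq_top]
  · intro s t hs hst ht
    rcases hst.eq_or_lt with rfl | hst'
    · simp
    have hs' : s ∈ Icc 0 l := ⟨hs, hst.trans ht⟩
    have ht' : t ∈ Icc 0 l := ⟨hs.trans hst, ht⟩
    have h1 := hg.abs_sub_le hγ hs hst' ht
    rw [hU s hs', hU t ht', EReal.abs_coe_sub_coe] at h1
    have h2 : |v (γ s) - v (γ t)| ≤ K * (t - s) :=
      (hv.dist_le_mul _ _).trans (mul_le_mul_of_nonneg_left (hγ.dist_le hs hst ht) K.2)
    calc ENNReal.ofReal |U s - v (γ s) - (U t - v (γ t))|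
        ≤ ENNReal.ofReal (|U s - U t| + |v (γ s) - v (γ t)|) := by
          refine ENNReal.ofReal_le_ofReal ?_
          rw [show U s - v (γ s) - (U t - v (γ t)) = U s - U t - (v (γ s) - v (γ t)) by ring]
          exact abs_sub _ _
      _ = ENNReal.ofReal |U s - U t| + ENNReal.ofReal |v (γ s) - v (γ t)| :=
          ENNReal.ofReal_add (abs_nonneg _) (abs_nonneg _)
      _ ≤ (∫⁻ τ in Icc s t, g (γ τ)) + ∫⁻ τ in Icc s t, (K : ℝ≥0∞) := by
          refine add_le_add h1 ((ENNReal.ofReal_le_ofReal h2).trans (le_of_eq ?_))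
          rw [ENNReal.ofReal_mul K.coe_nonneg]
          simp
      _ ≤ _ := le_lintegral_add _ _
  · intro t ht htA
    have h1 := huv _ htA
    rw [hU t ht] at h1
    simp [EReal.coe_eq_coe_iff.1 h1]

/-- The sum of upper gradients of `u` and of `u - v` is an upper gradient of `v`. -/
theorem IsUpperGradient.of_sub {P : Type*} [MetricSpace P] [MeasurableSpace P]
    {g G : P → ℝ≥0∞} {u : P → EReal} {v : P → ℝ} (hg : IsUpperGradient g u)
    (hG : IsUpperGradient G (fun x => u x - (v x : EReal))) :
    IsUpperGradient (fun x => g x + G x) (fun x => (v x : EReal)) := by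
  refine ⟨hg.1.add hG.1, fun l γ hl hγ => ?_⟩
  by_cases hfin : ∫⁻ t in Icc 0 l, g (γ t) = ⊤
  · refine le_trans le_top ?_
    rw [← hfin]
    exact lintegral_mono fun t => le_self_add
  obtain ⟨U, hU⟩ := hg.exists_real hl hγ hfin
  have h0 : (0 : ℝ) ∈ Icc 0 l := ⟨le_rfl, hl.le⟩
  have hl' : l ∈ Icc 0 l := ⟨hl.le, le_rfl⟩
  have h1 := hg.2 l γ hl hγ
  have h2 := hG.2 l γ hl hγ
  simp only [hU 0 h0, hU l hl', ← EReal.coe_sub, EReal.abs_def] at h1 h2 ⊢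
  refine le_trans ?_ ((add_le_add h1 h2).trans (le_lintegral_add _ _))
  rw [← ENNReal.ofReal_add (abs_nonneg _) (abs_nonneg _)]
  refine ENNReal.ofReal_le_ofReal ?_
  rw [show v (γ 0) - v (γ l) = U 0 - U l - (U 0 - v (γ 0) - (U l - v (γ l))) by ring]
  exact abs_sub _ _

/-! ### The quasi-norm on nonnegative functions and absolute continuity -/

theorem EReal.measurable_abs : Measurable EReal.abs :=
  EReal.measurable_of_measurable_real (measurable_id.abs.ennreal_ofReal)

@[simp]
theorem EReal.abs_coe_ennreal (a : ℝ≥0∞) : (a : EReal).abs = a := by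
  induction a with
  | top => rfl
  | coe r =>
    change ((r : ℝ) : EReal).abs = r
    rw [EReal.abs_def, abs_of_nonneg r.coe_nonneg, ENNReal.ofReal_coe_nnreal]

theorem EReal.abs_sub_le (a : EReal) (r : ℝ) :
    (a - (r : EReal)).abs ≤ a.abs + (r : EReal).abs := by
  induction a with
  | bot => simp
  | top => simp
  | coe s =>
    rw [EReal.abs_coe_sub_coe, EReal.abs_def, EReal.abs_def,
      ← ENNReal.ofReal_add (abs_nonneg _) (abs_nonneg _)]
    exact ENNReal.ofReal_le_ofReal (abs_sub _ _)

namespace QBFL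

variable {P : Type*} [MeasurableSpace P] {μ : Measure P} (X : QBFL μ)

/-- The quasi-norm on nonnegative functions. -/
noncomputable def enrm (f : P → ℝ≥0∞) : ℝ≥0∞ := X.nrm (fun x => (f x : EReal))

variable {X} {f g : P → ℝ≥0∞}

theorem enrm_mono (hf : AEMeasurable f μ) (hg : AEMeasurable g μ) (h : ∀ᵐ x ∂μ, f x ≤ g x) :
    X.enrm f ≤ X.enrm g :=
  X.nrm_mono _ _ hf.coe_ereal_ennreal hg.coe_ereal_ennreal (by simpa using h)

theorem nrm_eq_enrm_abs {u : P → EReal} (hu : AEMeasurable u μ) :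
    X.nrm u = X.enrm (fun x => (u x).abs) := by
  have h := (EReal.measurable_abs.comp_aemeasurable hu).coe_ereal_ennreal
  exact le_antisymm (X.nrm_mono _ _ hu h (by simp)) (X.nrm_mono _ _ h hu (by simp))

theorem enrm_add_le (hf : AEMeasurable f μ) (hg : AEMeasurable g μ) :
    X.enrm (fun x => f x + g x) ≤ X.conc * (X.enrm f + X.enrm g) := by
  have := X.nrm_add_le _ _ hf.coe_ereal_ennreal hg.coe_ereal_ennreal
  simpa only [enrm, EReal.coe_ennreal_add] using this

theorem enrm_const_mul (a : ℝ≥0) (hf : AEMeasurable f μ) :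
    X.enrm (fun x => a * f x) = a * X.enrm f := by
  have := X.nrm_smul a _ hf.coe_ereal_ennreal
  rw [abs_of_nonneg a.coe_nonneg, ENNReal.ofReal_coe_nnreal] at this
  rw [enrm, enrm, ← this]
  congr 1
  ext x
  rw [EReal.coe_ennreal_mul]
  rfl

theorem enrm_eq_zero (hf : AEMeasurable f μ) : X.enrm f = 0 ↔ f =ᵐ[μ] 0 := by
  refine (X.nrm_eq_zero _ hf.coe_ereal_ennreal).trans ?_
  simp [Filter.EventuallyEq]

theorem tendsto_enrm_add {ι : Type*} {l : Filter ι} {f g : ι → P → ℝ≥0∞}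
    (hf : ∀ i, AEMeasurable (f i) μ) (hg : ∀ i, AEMeasurable (g i) μ)
    (hf0 : Tendsto (fun i => X.enrm (f i)) l (𝓝 0))
    (hg0 : Tendsto (fun i => X.enrm (g i)) l (𝓝 0)) :
    Tendsto (fun i => X.enrm (fun x => f i x + g i x)) l (𝓝 0) := by
  have h := ENNReal.Tendsto.const_mul (a := (X.conc : ℝ≥0∞)) (hf0.add hg0)
    (Or.inr ENNReal.coe_ne_top)
  simp only [add_zero, mul_zero] at h
  exact tendsto_of_tendsto_of_tendsto_of_le_of_le tendsto_const_nhds h (fun _ => zero_le)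
    fun i => enrm_add_le (hf i) (hg i)

theorem tendsto_enrm_const_mul {ι : Type*} {l : Filter ι} {f : ι → P → ℝ≥0∞} (a : ℝ≥0)
    (hf : ∀ i, AEMeasurable (f i) μ) (hf0 : Tendsto (fun i => X.enrm (f i)) l (𝓝 0)) :
    Tendsto (fun i => X.enrm (fun x => a * f i x)) l (𝓝 0) := by
  have h := ENNReal.Tendsto.const_mul (a := (a : ℝ≥0∞)) hf0 (Or.inr ENNReal.coe_ne_top)
  rw [mul_zero] at h
  exact h.congr fun i => (enrm_const_mul a (hf i)).symm

/-- Functions whose truncated superlevel sets tend to zero in the quasi-norm are a.e. finite. -/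
theorem ae_lt_top_of_tendsto_enrm (hf : Measurable f)
    (h : Tendsto (fun n : ℕ => X.enrm ({x | (n : ℝ≥0∞) < f x}.indicator fun _ => (n : ℝ≥0∞)))
      atTop (𝓝 0)) : ∀ᵐ x ∂μ, f x < ⊤ := by
  have hm : MeasurableSet {x | f x = ⊤} := hf (measurableSet_singleton _)
  have h0 : X.enrm ({x | f x = ⊤}.indicator 1) = 0 := by
    refine le_antisymm (ge_of_tendsto h ?_) zero_le
    -- The value `n = 0` must be excluded, since its truncation is the zero function.
    filter_upwards [eventually_ge_atTop 1] with n hn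
    refine enrm_mono (measurable_one.indicator hm).aemeasurable
      (measurable_const.indicator (measurableSet_lt measurable_const hf)).aemeasurable
      (Eventually.of_forall fun x => ?_)
    by_cases hx : f x = ⊤
    · simp only [indicator, mem_ofPred_eq, hx, ENNReal.natCast_lt_top, if_true, Pi.one_apply]
      exact_mod_cast hn
    · simp [indicator, hx]
  rw [enrm_eq_zero (measurable_one.indicator hm).aemeasurable] at h0
  filter_upwards [h0] with x hx
  by_contra hc
  simp [top_le_iff.1 (not_lt.1 hc)] at hx

/-- Every multiple `n χ_{f = ∞}` lies below `f`, so by homogeneity `χ_{f = ∞}` has quasi-norm zero.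
-/
theorem ae_lt_top_of_enrm_ne_top (hf : Measurable f) (h : X.enrm f ≠ ⊤) : ∀ᵐ x ∂μ, f x < ⊤ := by
  have hm : MeasurableSet {x | f x = ⊤} := hf (measurableSet_singleton _)
  have hi : AEMeasurable ({x | f x = ⊤}.indicator (1 : P → ℝ≥0∞)) μ :=
    (measurable_one.indicator hm).aemeasurable
  have h0 : X.enrm ({x | f x = ⊤}.indicator 1) = 0 := by
    by_contra hc
    obtain ⟨n, hn⟩ := ENNReal.exists_nat_mul_gt hc h
    refine hn.not_ge ?_
    have h1 := enrm_const_mul (X := X) (n : ℝ≥0) hi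
    simp only [ENNReal.coe_natCast] at h1
    rw [← h1]
    refine enrm_mono (hi.const_mul _) hf.aemeasurable (Eventually.of_forall fun x => ?_)
    by_cases hx : f x = ⊤ <;> simp [indicator, hx]
  rw [enrm_eq_zero hi] at h0
  filter_upwards [h0] with x hx
  by_contra hc
  simp [top_le_iff.1 (not_lt.1 hc)] at hx

theorem IsAbsCont.tendsto_enrm_indicator (hX : X.IsAbsCont) (hf : AEMeasurable f μ)
    (hfin : X.enrm f < ⊤) {E : ℕ → Set P} (hE : Antitone E) (hEm : ∀ n, MeasurableSet (E n))
    (h0 : μ (⋂ n, E n) = 0) :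
    Tendsto (fun n => X.enrm ((E n).indicator f)) atTop (𝓝 0) := by
  refine (hX _ ⟨hf.coe_ereal_ennreal, hfin⟩ E hE (fun n => (hEm n).nullMeasurableSet) h0).congr
    fun n => ?_
  unfold enrm
  congr 1
  ext x
  by_cases hx : x ∈ E n <;> simp [hx]

/-- Chebyshev's inequality upgraded by absolute continuity. -/
theorem IsAbsCont.tendsto_enrm_superlevel (hX : X.IsAbsCont) (hf : Measurable f)
    (hfin : X.enrm f < ⊤) :
    Tendsto (fun n : ℕ => X.enrm ({x | (n : ℝ≥0∞) < f x}.indicator fun _ => (n : ℝ≥0∞)))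
      atTop (𝓝 0) := by
  have hm : ∀ n : ℕ, MeasurableSet {x | (n : ℝ≥0∞) < f x} := fun n =>
    measurableSet_lt measurable_const hf
  refine tendsto_of_tendsto_of_tendsto_of_le_of_le tendsto_const_nhds
    (hX.tendsto_enrm_indicator hf.aemeasurable hfin (E := fun n => {x | (n : ℝ≥0∞) < f x})
      (fun m n hmn x (hx : (n : ℝ≥0∞) < f x) => (Nat.cast_le.2 hmn).trans_lt hx) hm ?_)
    (fun _ => zero_le) fun n => ?_
  · refine measure_mono_null (fun x hx => ?_) (ae_iff.1 (ae_lt_top_of_enrm_ne_top hf hfin.ne))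
    intro hc
    obtain ⟨n, hn⟩ := ENNReal.exists_nat_gt hc.ne
    exact lt_asymm hn (mem_iInter.1 hx n)
  · refine enrm_mono (measurable_const.indicator (hm n)).aemeasurable
      (hf.indicator (hm n)).aemeasurable (Eventually.of_forall fun x => ?_)
    exact indicator_le_indicator' fun hx => le_of_lt hx

end QBFL

/-! ### Superlevel sets of finite measure -/

section NonatomicMeasure

variable {P : Type*} [MetricSpace P] [MeasurableSpace P] [BorelSpace P] {μ : Measure P}

/-- A disjoint family of balls of positive measure is countable by σ-finiteness; the Vitali covering
lemma for balls of one fixed radius then makes their centres a countable `ε`-net. -/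
theorem secondCountableTopology_of_ball_pos [SigmaFinite μ]
    (hball : ∀ (x : P) (r : ℝ), 0 < r → 0 < μ (Metric.ball x r)) :
    SecondCountableTopology P := by
  refine Metric.secondCountable_of_almost_dense_set fun ε hε => ?_
  obtain ⟨s, -, hdisj, hcov⟩ := Vitali.exists_disjoint_subfamily_covering_enlargement_closedBall
    (univ : Set P) id (fun _ => ε / 5) (ε / 5) (fun _ _ => le_rfl) 5 (by norm_num)
  refine ⟨s, ?_, fun x => ?_⟩
  · have h := Measure.countable_meas_pos_of_disjoint_iUnion (μ := μ)
      (As := fun i : s => Metric.closedBall (i : P) (ε / 5))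
      (fun i => Metric.isClosed_closedBall.measurableSet)
      (fun i j hij => hdisj i.2 j.2 (fun h => hij (Subtype.ext h)))
    have hu : {i : s | 0 < μ (Metric.closedBall (i : P) (ε / 5))} = univ :=
      eq_univ_of_forall fun i => (hball i (ε / 5) (by positivity)).trans_le
        (measure_mono Metric.ball_subset_closedBall)
    rw [hu, countable_univ_iff] at h
    exact h
  · obtain ⟨b, hb, hsub⟩ := hcov x (mem_univ x)
    refine ⟨b, hb, ?_⟩
    have := hsub (Metric.mem_closedBall_self (by positivity))
    rw [Metric.mem_closedBall, id_eq, id_eq] at this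
    linarith

theorem IsNonatomic.measure_singleton (hna : IsNonatomic μ) (x : P) : μ {x} = 0 := by
  by_contra hc
  obtain ⟨B, hB, -, h0, h1⟩ := hna {x} (measurableSet_singleton x) (pos_iff_ne_zero.2 hc)
  rcases subset_singleton_iff_eq.1 hB with rfl | rfl
  · simp at h0
  · exact lt_irrefl _ h1

/-- Sets of infinite measure contain subsets of comparable prescribed measure. -/
theorem IsNonatomic.exists_subset_measure (hna : IsNonatomic μ) [SecondCountableTopology P]
    (hball : ∀ (x : P) (r : ℝ), 0 < r → μ (Metric.ball x r) < ⊤) {S : Set P}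
    (hS : MeasurableSet S) (hSinf : μ S = ⊤) {c : ℝ≥0} (hc : 0 < c) :
    ∃ T ⊆ S, MeasurableSet T ∧ (c : ℝ≥0∞) ≤ μ T ∧ μ T ≤ 2 * c := by
  -- Balls shrinking to a point have measure tending to that of the point, which is zero.
  have hsmall : ∀ x : P, ∃ r : ℝ, 0 < r ∧ μ (Metric.ball x r) < c := by
    intro x
    have h := tendsto_measure_iInter_atTop (μ := μ)
      (s := fun n : ℕ => Metric.ball x (1 / ((n : ℝ) + 1)))
      (fun n => Metric.isOpen_ball.measurableSet.nullMeasurableSet)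
      (fun m n hmn => Metric.ball_subset_ball (one_div_le_one_div_of_le (by positivity)
        (by exact_mod_cast Nat.succ_le_succ hmn)))
      ⟨0, (hball x _ (by positivity)).ne⟩
    have hI : ⋂ n : ℕ, Metric.ball x (1 / ((n : ℝ) + 1)) ⊆ {x} := by
      intro y hy
      rw [mem_singleton_iff, ← dist_le_zero]
      refine le_of_forall_pos_lt_add fun ε hε => ?_
      obtain ⟨n, hn⟩ := exists_nat_one_div_lt hε
      have := Metric.mem_ball.1 (mem_iInter.1 hy n)
      linarith
    rw [measure_mono_null hI (hna.measure_singleton x)] at h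
    obtain ⟨n, hn⟩ := (h.eventually_lt_const (ENNReal.coe_pos.2 hc)).exists
    exact ⟨_, by positivity, hn⟩
  choose r hr0 hr using hsmall
  obtain ⟨D, hDc, hD⟩ := TopologicalSpace.countable_cover_nhds
    (fun x => Metric.ball_mem_nhds x (hr0 x))
  have hDne : D.Nonempty := by
    rw [nonempty_iff_ne_empty]
    rintro rfl
    have : S = ∅ := by
      rw [← univ_inter S, ← hD]; simp
    simp [this] at hSinf
  obtain ⟨e, he⟩ := hDc.exists_eq_range hDne
  -- Each new ball adds measure less than `c`, so the first `A n` whose measure reaches `c` cannot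
  -- exceed `2 * c`.
  set A : ℕ → Set P := fun n => S ∩ ⋃ i ∈ Finset.range n, Metric.ball (e i) (r (e i)) with hA
  have hAm : ∀ n, MeasurableSet (A n) := fun n =>
    hS.inter (Finset.measurableSet_biUnion _ fun i _ => Metric.isOpen_ball.measurableSet)
  have hAmono : Monotone A := fun m n hmn =>
    inter_subset_inter_right _ (biUnion_subset_biUnion_left fun i hi => by
      simp only [Finset.coe_range, mem_Iio, Finset.mem_range] at *
      exact lt_of_lt_of_le hi hmn)
  have hAU : ⋃ n, A n = S := by
    refine Subset.antisymm (iUnion_subset fun n => inter_subset_left) fun x hx => ?_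
    have hx' : x ∈ ⋃ y ∈ D, Metric.ball y (r y) := hD ▸ mem_univ x
    rw [he, biUnion_range] at hx'
    obtain ⟨i, hi⟩ := mem_iUnion.1 hx'
    exact mem_iUnion.2 ⟨i + 1, hx, mem_biUnion (Finset.mem_range.2 (Nat.lt_succ_self i)) hi⟩
  have hlim := tendsto_measure_iUnion_atTop (μ := μ) hAmono
  rw [hAU, hSinf] at hlim
  have hex : ∃ n, (c : ℝ≥0∞) ≤ μ (A n) :=
    ((hlim.eventually_const_lt ENNReal.coe_lt_top).exists).imp fun _ h => h.le
  classical
  obtain ⟨n, hn, hmin⟩ : ∃ n, (c : ℝ≥0∞) ≤ μ (A n) ∧ ∀ m < n, ¬ (c : ℝ≥0∞) ≤ μ (A m) :=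
    ⟨Nat.find hex, Nat.find_spec hex, fun m => Nat.find_min hex⟩
  refine ⟨A n, inter_subset_left, hAm n, hn, ?_⟩
  cases n with
  | zero => simp [hA]
  | succ k =>
    have hsub : A (k + 1) ⊆ A k ∪ Metric.ball (e k) (r (e k)) := by
      rintro x ⟨hxS, hx⟩
      obtain ⟨i, hi, hxi⟩ := mem_iUnion₂.1 hx
      rcases (Nat.lt_succ_iff_lt_or_eq.1 (Finset.mem_range.1 hi)) with h | rfl
      · exact Or.inl ⟨hxS, mem_biUnion (Finset.mem_range.2 h) hxi⟩
      · exact Or.inr hxi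
    rw [two_mul]
    exact (measure_mono hsub).trans ((measure_union_le _ _).trans
      (add_le_add (not_le.1 (hmin k (Nat.lt_succ_self k))).le (hr _).le))

/-- If `f` is `q`-integrable on all sets of finite measure, then `f` has a superlevel set of
finite measure. -/
theorem IsNonatomic.exists_measure_superlevel_lt_top (hna : IsNonatomic μ) [SigmaFinite μ]
    (hball : ∀ (x : P) (r : ℝ), 0 < r → 0 < μ (Metric.ball x r) ∧ μ (Metric.ball x r) < ⊤)
    {f : P → ℝ≥0∞} (hf : Measurable f) {q : ℝ} (hq : 0 < q)
    (hfq : ∀ E : Set P, MeasurableSet E → μ E < ⊤ → ∫⁻ x in E, f x ^ q ∂μ < ⊤) :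
    ∃ σ : ℝ≥0, μ {x | (σ : ℝ≥0∞) < f x} < ⊤ := by
  have := secondCountableTopology_of_ball_pos (μ := μ) fun x r hr => (hball x r hr).1
  by_contra! hcon
  -- On `T n` one has `f ^ q > 4 ^ n`, and the measure of `T n` is comparable to `2⁻ⁿ`: the union
  -- has finite measure, yet the integral over it is at least `2 ^ n` for every `n`.
  have hT : ∀ n : ℕ, ∃ T ⊆ {x | (((4 : ℝ≥0) ^ n) ^ q⁻¹ : ℝ≥0) < f x}, MeasurableSet T ∧
      (((2 : ℝ≥0) ^ n)⁻¹ : ℝ≥0) ≤ μ T ∧ μ T ≤ 2 * (((2 : ℝ≥0) ^ n)⁻¹ : ℝ≥0) := fun n =>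
    hna.exists_subset_measure (fun x r hr => (hball x r hr).2)
      (measurableSet_lt measurable_const hf) (top_le_iff.1 (hcon _)) (by positivity)
  choose T hTf hTm hT1 hT2 using hT
  have hfin : μ (⋃ n, T n) < ⊤ := by
    refine (measure_iUnion_le _).trans_lt ((ENNReal.tsum_le_tsum hT2).trans_lt ?_)
    rw [ENNReal.tsum_mul_left]
    refine ENNReal.mul_lt_top (by simp) ?_
    have : ∑' n : ℕ, ((((2 : ℝ≥0) ^ n)⁻¹ : ℝ≥0) : ℝ≥0∞) = 2 := by
      rw [← ENNReal.tsum_geometric_two]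
      refine tsum_congr fun n => ?_
      rw [ENNReal.coe_inv (by positivity), ENNReal.coe_pow, ENNReal.inv_pow]; simp
    rw [this]; simp
  refine (hfq _ (MeasurableSet.iUnion hTm) hfin).ne (ENNReal.eq_top_of_forall_nnreal_le fun C => ?_)
  obtain ⟨n, hn⟩ := pow_unbounded_of_one_lt C (one_lt_two : (1 : ℝ≥0) < 2)
  calc (C : ℝ≥0∞) ≤ ((4 : ℝ≥0) ^ n : ℝ≥0) * ((((2 : ℝ≥0) ^ n)⁻¹ : ℝ≥0) : ℝ≥0∞) := by
        rw [← ENNReal.coe_mul, ENNReal.coe_le_coe]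
        rw [show (4 : ℝ≥0) = 2 * 2 by norm_num, mul_pow, mul_assoc,
          mul_inv_cancel₀ (by positivity), mul_one]
        exact hn.le
    _ ≤ ((4 : ℝ≥0) ^ n : ℝ≥0) * μ (T n) := by gcongr; exact hT1 n
    _ = ∫⁻ _ in T n, ((4 : ℝ≥0) ^ n : ℝ≥0) ∂μ := by simp
    _ ≤ ∫⁻ x in T n, f x ^ q ∂μ := by
        refine setLIntegral_mono (hf.pow_const q) fun x hx => ?_
        have h1 := (ENNReal.rpow_lt_rpow (hTf n hx) hq).le
        rwa [← ENNReal.coe_rpow_of_nonneg _ hq.le, ← NNReal.rpow_mul,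
          inv_mul_cancel₀ hq.ne', NNReal.rpow_one] at h1
    _ ≤ _ := lintegral_mono_set (subset_iUnion T n)

end NonatomicMeasure

/-! ### Lipschitz extension and approximation in the Newtonian quasi-norm -/

/-- A bounded function with bounded Hajłasz gradient on a set extends to a bounded Lipschitz
function on the whole space. -/
theorem exists_lipschitz_extension_of_hajlasz {P : Type*} [PseudoMetricSpace P] {u : P → EReal}
    {h : P → ℝ≥0∞} {S : Set P} {σ : ℝ≥0}
    (hu : ∀ x ∈ S, ∀ y ∈ S, (u x - u y).abs ≤ edist x y * (h x + h y))
    (hh : ∀ x ∈ S, h x ≤ σ) (hS : ∀ x ∈ S, (u x).abs ≤ σ) :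
    ∃ v : P → ℝ, LipschitzWith (2 * σ) v ∧ (∀ x, |v x| ≤ σ) ∧ ∀ x ∈ S, u x = (v x : EReal) := by
  have hreal : ∀ x ∈ S, u x = ((u x).toReal : EReal) := by
    intro x hx
    have h1 := (hS x hx).trans_lt ENNReal.coe_lt_top
    refine (EReal.coe_toReal ?_ ?_).symm <;> intro hc <;> simp [hc] at h1
  have hlip : LipschitzOnWith (2 * σ) (fun x => (u x).toReal) S := by
    intro x hx y hy
    have h1 := hu x hx y hy
    rw [hreal x hx, hreal y hy, EReal.abs_coe_sub_coe, ← Real.dist_eq, ← edist_dist] at h1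
    refine h1.trans ?_
    rw [mul_comm]
    gcongr
    rw [two_mul, ENNReal.coe_add]
    exact add_le_add (hh x hx) (hh y hy)
  obtain ⟨w, hw, hwS⟩ := hlip.extend_real
  -- Truncating at `±σ` keeps the Lipschitz constant and changes nothing on `S`.
  refine ⟨fun x => max (-σ : ℝ) (min (w x) σ), (hw.min_const _).const_max _, fun x => ?_,
    fun x hx => ?_⟩
  · have := σ.coe_nonneg
    rw [abs_le]
    exact ⟨le_max_left _ _, max_le (by linarith) (min_le_right _ _)⟩
  · have h1 := hS x hx
    rw [hreal x hx, EReal.abs_def, ENNReal.ofReal_le_iff_le_toReal ENNReal.coe_ne_top,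
      ENNReal.coe_toReal, abs_le] at h1
    have h2 : (u x).toReal = w x := hwS hx
    rw [h2] at h1
    simp only
    rw [min_eq_left h1.2, max_eq_right h1.1, ← h2]
    exact hreal x hx

section Newton

variable {P : Type*} [MetricSpace P] [MeasurableSpace P] {μ : Measure P} {X : QBFL μ}

theorem exists_isUpperGradient_of_newtonNorm_lt_top {u : P → EReal} (hu : newtonNorm X u < ⊤) :
    ∃ g : P → ℝ≥0∞, IsUpperGradient g u ∧ X.enrm g < ⊤ := by
  have h1 := (ENNReal.add_lt_top.1 hu).2
  simp only [iInf_lt_iff] at h1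
  obtain ⟨g, hg, hfin⟩ := h1
  exact ⟨g, hg, hfin⟩

theorem newtonNorm_le {u : P → EReal} {g : P → ℝ≥0∞} (hu : AEMeasurable u μ)
    (hg : IsUpperGradient g u) :
    newtonNorm X u ≤ X.enrm (fun x => (u x).abs) + X.enrm g :=
  add_le_add (QBFL.nrm_eq_enrm_abs hu).le (iInf₂_le g hg)

/-- Write `v = u - (u - v)`; this places the approximants themselves in the Newtonian space. -/
theorem MemNewton.of_sub {u : P → EReal} {v : P → ℝ} (hu : MemNewton X u)
    (hv : AEMeasurable v μ) (huv : newtonNorm X (fun x => u x - (v x : EReal)) < ⊤) :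
    MemNewton X (fun x => (v x : EReal)) := by
  have hw : AEMeasurable (fun x => u x - (v x : EReal)) μ := by
    simp only [sub_eq_add_neg]
    exact hu.1.add hv.coe_real_ereal.neg
  obtain ⟨g, hg, hgfin⟩ := exists_isUpperGradient_of_newtonNorm_lt_top hu.2
  obtain ⟨G, hG, hGfin⟩ := exists_isUpperGradient_of_newtonNorm_lt_top huv
  have hua := EReal.measurable_abs.comp_aemeasurable hu.1
  have hwa := EReal.measurable_abs.comp_aemeasurable hw
  have hva := EReal.measurable_abs.comp_aemeasurable hv.coe_real_ereal
  have hufin : X.enrm (fun x => (u x).abs) < ⊤ :=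
    QBFL.nrm_eq_enrm_abs hu.1 ▸ (ENNReal.add_lt_top.1 hu.2).1
  have hwfin : X.enrm (fun x => (u x - (v x : EReal)).abs) < ⊤ :=
    QBFL.nrm_eq_enrm_abs hw ▸ (ENNReal.add_lt_top.1 huv).1
  have hadd : ∀ a b : ℝ≥0∞, a < ⊤ → b < ⊤ → (X.conc : ℝ≥0∞) * (a + b) < ⊤ := fun a b ha hb =>
    ENNReal.mul_lt_top ENNReal.coe_lt_top (ENNReal.add_lt_top.2 ⟨ha, hb⟩)
  refine ⟨hv.coe_real_ereal, (newtonNorm_le hv.coe_real_ereal (hg.of_sub hG)).trans_lt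
    (ENNReal.add_lt_top.2 ⟨?_, ?_⟩)⟩
  · refine lt_of_le_of_lt ?_ (hadd _ _ hufin hwfin)
    refine le_trans (QBFL.enrm_mono hva (hua.add hwa) (Eventually.of_forall fun x => ?_))
      (QBFL.enrm_add_le hua hwa)
    change (v x : EReal).abs ≤ (u x).abs + (u x - (v x : EReal)).abs
    induction u x with
    | bot => simp
    | top => simp
    | coe r =>
      rw [EReal.abs_coe_sub_coe, EReal.abs_def, EReal.abs_def,
        ← ENNReal.ofReal_add (abs_nonneg _) (abs_nonneg _)]
      refine ENNReal.ofReal_le_ofReal ?_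
      have := abs_sub r (r - v x)
      rwa [sub_sub_cancel] at this
  · exact (QBFL.enrm_add_le hg.1.aemeasurable hG.1.aemeasurable).trans_lt (hadd _ _ hgfin hGfin)

end Newton

/-- Lipschitz approximation in the Newtonian quasi-norm, with `f` and `h'` Borel versions of `|u|`
and of its Hajłasz gradient, and `N` a null set containing the exceptional points. -/
theorem exists_lipschitz_tendsto_newtonNorm {P : Type*} [MetricSpace P] [MeasurableSpace P]
    [BorelSpace P] {μ : Measure P} {X : QBFL μ} (hX : X.IsAbsCont) {u : P → EReal}
    (hu : MemNewton X u) {h h' f : P → ℝ≥0∞} (hh' : Measurable h') (hf : Measurable f)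
    {N : Set P} (hN : MeasurableSet N) (hN0 : μ N = 0)
    (hhaj : ∀ x ∉ N, ∀ y ∉ N, (u x - u y).abs ≤ edist x y * (h x + h y))
    (hhN : ∀ x ∉ N, h x = h' x) (huN : ∀ x ∉ N, (u x).abs = f x)
    {A : ℕ → Set P} (hA : ∀ n : ℕ, A n = N ∪ {x | (n : ℝ≥0∞) < h' x} ∪ {x | (n : ℝ≥0∞) < f x})
    (hA0 : μ (⋂ n, A n) = 0)
    (hweak : Tendsto (fun n : ℕ =>
      X.enrm ({x | (n : ℝ≥0∞) < h' x}.indicator fun _ => (n : ℝ≥0∞))) atTop (𝓝 0)) :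
    ∃ v : ℕ → P → ℝ, (∀ n, ∃ K : ℝ≥0, LipschitzWith K (v n)) ∧
      (∀ n, ∀ x ∉ A n, u x = (v n x : EReal)) ∧
      Tendsto (fun n => newtonNorm X (fun x => u x - (v n x : EReal))) atTop (𝓝 0) := by
  have hmem : ∀ n x, x ∈ A n ↔ (x ∈ N ∨ (n : ℝ≥0∞) < h' x) ∨ (n : ℝ≥0∞) < f x := by
    intro n x; rw [hA]; rfl
  have hHm : ∀ n : ℕ, MeasurableSet {x | (n : ℝ≥0∞) < h' x} := fun n =>
    measurableSet_lt measurable_const hh'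
  have hAm : ∀ n, MeasurableSet (A n) := fun n => by
    rw [hA]; exact (hN.union (hHm n)).union (measurableSet_lt measurable_const hf)
  have hAanti : Antitone A := by
    intro m n hmn x hx
    have hc : (m : ℝ≥0∞) ≤ n := Nat.cast_le.2 hmn
    rw [hmem] at hx ⊢
    exact hx.imp (Or.imp_right hc.trans_lt) hc.trans_lt
  have hext : ∀ n : ℕ, ∃ v : P → ℝ, LipschitzWith (2 * n) v ∧ (∀ x, |v x| ≤ n) ∧
      ∀ x ∈ (A n)ᶜ, u x = (v x : EReal) := by
    intro n
    have hn : ∀ x ∈ (A n)ᶜ, x ∉ N ∧ h' x ≤ n ∧ f x ≤ n := by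
      intro x hx
      rw [mem_compl_iff, hmem] at hx
      push Not at hx
      exact ⟨hx.1.1, hx.1.2, hx.2⟩
    have := exists_lipschitz_extension_of_hajlasz (u := u) (h := h) (S := (A n)ᶜ) (σ := n)
      (fun x hx y hy => hhaj x (hn x hx).1 y (hn y hy).1)
      (fun x hx => by rw [hhN x (hn x hx).1]; simpa using (hn x hx).2.1)
      (fun x hx => by rw [huN x (hn x hx).1]; simpa using (hn x hx).2.2)
    simpa using this
  choose v hvlip hvbd hvA using hext
  refine ⟨v, fun n => ⟨_, hvlip n⟩, fun n x hx => hvA n x hx, ?_⟩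
  obtain ⟨g, hg, hgfin⟩ := exists_isUpperGradient_of_newtonNorm_lt_top hu.2
  have hNae : ∀ᵐ x ∂μ, x ∉ N := measure_eq_zero_iff_ae_notMem.1 hN0
  have hffin : X.enrm f < ⊤ := by
    refine lt_of_le_of_lt ?_ (QBFL.nrm_eq_enrm_abs hu.1 ▸ (ENNReal.add_lt_top.1 hu.2).1)
    refine QBFL.enrm_mono hf.aemeasurable (EReal.measurable_abs.comp_aemeasurable hu.1) ?_
    filter_upwards [hNae] with x hx using (huN x hx).ge
  set H : ℕ → P → ℝ≥0∞ := fun n => {x | (n : ℝ≥0∞) < h' x}.indicator fun _ => (n : ℝ≥0∞)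
  set fA : ℕ → P → ℝ≥0∞ := fun n => (A n).indicator f
  set gA : ℕ → P → ℝ≥0∞ := fun n => (A n).indicator g
  have hH : ∀ n, AEMeasurable (H n) μ := fun n => (measurable_const.indicator (hHm n)).aemeasurable
  have hfA : ∀ n, AEMeasurable (fA n) μ := fun n => (hf.indicator (hAm n)).aemeasurable
  have hgA : ∀ n, AEMeasurable (gA n) μ := fun n => (hg.1.indicator (hAm n)).aemeasurable
  have tf : Tendsto (fun n => X.enrm (fA n)) atTop (𝓝 0) :=
    hX.tendsto_enrm_indicator hf.aemeasurable hffin hAanti hAm hA0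
  have tg : Tendsto (fun n => X.enrm (gA n)) atTop (𝓝 0) :=
    hX.tendsto_enrm_indicator hg.1.aemeasurable hgfin hAanti hAm hA0
  have tb := QBFL.tendsto_enrm_add hfA hH tf hweak
  have hb : ∀ n, AEMeasurable (fun x => fA n x + H n x) μ := fun n => (hfA n).add (hH n)
  -- This bound controls both the size `n` of `v n` and its Lipschitz constant `2 * n` on `A n` by
  -- quantities that vanish in the limit.
  have hnb : ∀ n : ℕ, ∀ x ∈ A n, x ∉ N → (n : ℝ≥0∞) ≤ fA n x + H n x := by
    intro n x hx hxN
    rcases (hmem n x).1 hx with (h1 | h1) | h1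
    · exact absurd h1 hxN
    · refine le_add_left ?_
      simp [H, h1]
    · refine le_add_right ?_
      simpa [fA, hx] using h1.le
  have hw : ∀ n, AEMeasurable (fun x => u x - (v n x : EReal)) μ := fun n => by
    simp only [sub_eq_add_neg]
    exact hu.1.add (hvlip n).continuous.measurable.coe_real_ereal.aemeasurable.neg
  -- Any positive sequence tending to zero would do: positivity handles the curves on which `g` is
  -- not integrable, and the limit removes the extra term.
  set δ : ℕ → ℝ≥0 := fun n => ((n : ℝ≥0) + 1)⁻¹
  have hδ : ∀ n, δ n ≠ 0 := fun n => by simp only [δ]; positivity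
  have tδ : Tendsto (fun n => X.enrm (fun x => δ n * g x)) atTop (𝓝 0) := by
    have h1 : Tendsto (fun n => (δ n : ℝ≥0∞)) atTop (𝓝 0) := by
      have : Tendsto δ atTop (𝓝 0) := by
        have := tendsto_one_div_add_atTop_nhds_zero_nat (𝕜 := ℝ≥0)
        simpa [δ] using this
      exact ENNReal.coe_zero ▸ ENNReal.tendsto_coe.2 this
    have h2 := ENNReal.Tendsto.mul_const (b := X.enrm g) h1 (Or.inr hgfin.ne)
    rw [zero_mul] at h2
    exact h2.congr fun n => (QBFL.enrm_const_mul _ hg.1.aemeasurable).symm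
  have tG := QBFL.tendsto_enrm_add (fun n => (hgA n).add ((hb n).const_mul (2 : ℝ≥0)))
    (fun n => hg.1.aemeasurable.const_mul (δ n : ℝ≥0∞))
    (QBFL.tendsto_enrm_add hgA (fun n => (hb n).const_mul (2 : ℝ≥0)) tg
      (QBFL.tendsto_enrm_const_mul 2 hb tb)) tδ
  have tu := QBFL.tendsto_enrm_add hfA hb tf tb
  have tsum := tu.add tG
  rw [add_zero] at tsum
  refine tendsto_of_tendsto_of_tendsto_of_le_of_le tendsto_const_nhds tsum (fun _ => zero_le)
    fun n => ?_
  have hG := hg.sub_lipschitz (hvlip n) (hAm n) (fun x hx => hvA n x hx) (hδ n)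
  refine (newtonNorm_le (hw n) hG).trans (add_le_add ?_ ?_)
  · refine QBFL.enrm_mono (EReal.measurable_abs.comp_aemeasurable (hw n)) ((hfA n).add (hb n)) ?_
    filter_upwards [hNae] with x hxN
    by_cases hx : x ∈ A n
    · refine (EReal.abs_sub_le _ _).trans (add_le_add ?_ (le_trans ?_ (hnb n x hx hxN)))
      · simp [fA, hx, huN x hxN]
      · rw [EReal.abs_def]
        exact ENNReal.ofReal_le_of_le_toReal (by simpa using hvbd n x)
    · rw [hvA n x hx, EReal.abs_coe_sub_coe]
      simp
  · refine QBFL.enrm_mono hG.1.aemeasurable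
      (((hgA n).add ((hb n).const_mul (2 : ℝ≥0))).add
        (hg.1.aemeasurable.const_mul (δ n : ℝ≥0∞))) ?_
    filter_upwards [hNae] with x hxN
    refine add_le_add ?_ le_rfl
    by_cases hx : x ∈ A n
    · simp only [indicator_of_mem hx]
      refine add_le_add ?_ ?_
      · simp [gA, hx]
      · rw [ENNReal.coe_mul, ENNReal.coe_natCast]
        exact mul_le_mul_right (hnb n x hx hxN) _
    · simp [hx]

/-! ### Finite superlevel sets from the embedding, and the theorem -/

/-- If `X` embeds into `L^q` on sets of finite measure, then every `f` that is small at infinity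
in the weak sense has a superlevel set of finite measure. -/
theorem exists_measure_superlevel_lt_top_of_tendsto_enrm {P : Type*} [MetricSpace P]
    [MeasurableSpace P] [BorelSpace P] {μ : Measure P} [SigmaFinite μ] (hna : IsNonatomic μ)
    (hball : ∀ (x : P) (r : ℝ), 0 < r → 0 < μ (Metric.ball x r) ∧ μ (Metric.ball x r) < ⊤)
    {X : QBFL μ} {f : P → ℝ≥0∞} (hf : Measurable f)
    (hweak : Tendsto (fun n : ℕ =>
      X.enrm ({x | (n : ℝ≥0∞) < f x}.indicator fun _ => (n : ℝ≥0∞))) atTop (𝓝 0))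
    {q : ℝ} (hq : 0 < q) (hXq : ∀ f : P → EReal, X.Mem f → MemLqFin μ q f) :
    ∃ σ : ℝ≥0, μ {x | (σ : ℝ≥0∞) < f x} < ⊤ := by
  set H : ℕ → P → ℝ≥0∞ := fun n => {x | (n : ℝ≥0∞) < f x}.indicator fun _ => (n : ℝ≥0∞)
  have hH : ∀ n, Measurable (H n) := fun n =>
    measurable_const.indicator (measurableSet_lt measurable_const hf)
  -- The factor `conc ^ (k + 1)` is the Riesz–Fischer weight, so the sum `F` lies in `X`; the
  -- condition `n ≥ k` gives `F ≥ k` on the superlevel set of `f` at level `n k`.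
  have hex : ∀ k : ℕ, ∃ n ≥ k, (X.conc : ℝ≥0∞) ^ (k + 1) * X.enrm (H n) ≤ 2⁻¹ ^ k := by
    intro k
    have h1 := ENNReal.Tendsto.const_mul (a := (X.conc : ℝ≥0∞) ^ (k + 1)) hweak
      (Or.inr (ENNReal.pow_ne_top ENNReal.coe_ne_top))
    rw [mul_zero] at h1
    have h2 : (0 : ℝ≥0∞) < 2⁻¹ ^ k := ENNReal.pow_pos (by simp) k
    obtain ⟨n, hn, hkn⟩ := ((h1.eventually_le_const h2).and (eventually_ge_atTop k)).exists
    exact ⟨n, hkn, hn⟩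
  choose n hkn hn using hex
  set F : P → ℝ≥0∞ := fun x => ∑' k, H (n k) x
  have hF : Measurable F := Measurable.tsum fun k => hH (n k)
  have hFfin : X.enrm F < ⊤ := by
    refine (X.riesz_fischer (fun k => H (n k)) fun k => (hH _).aemeasurable).trans_lt
      ((ENNReal.tsum_le_tsum hn).trans_lt ?_)
    rw [ENNReal.tsum_geometric_two]
    simp
  have hFq := hXq _ ⟨hF.coe_ereal_ennreal.aemeasurable, hFfin⟩
  obtain ⟨σ, hσ⟩ := hna.exists_measure_superlevel_lt_top hball hF hq fun E hE hE' => by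
    simpa using hFq.2 E hE.nullMeasurableSet hE'
  obtain ⟨k, hk⟩ := exists_nat_gt σ
  refine ⟨n k, (measure_mono fun x hx => ?_).trans_lt hσ⟩
  have hx' : (n k : ℝ≥0∞) < f x := by simpa using hx
  have h1 : (n k : ℝ≥0∞) ≤ F x := by
    refine le_trans ?_ (ENNReal.le_tsum k)
    simp [H, hx']
  refine lt_of_lt_of_le ?_ h1
  have h2 : (σ : ℝ≥0∞) < k := by exact_mod_cast hk
  exact h2.trans_le (Nat.cast_le.2 (hkn k))

theorem mainTheorem6 {P : Type*} [MetricSpace P] [MeasurableSpace P] [BorelSpace P]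
    (μ : Measure P) [SigmaFinite μ] (hna : IsNonatomic μ)
    (hball : ∀ (x : P) (r : ℝ), 0 < r → 0 < μ (Metric.ball x r) ∧ μ (Metric.ball x r) < ⊤)
    (X : QBFL μ) (hX : X.IsAbsCont)
    (u : P → EReal) (hu : MemNewton X u)
    (h : P → ℝ≥0∞) (hh : IsHajlaszGradient μ h u)
    (hweak :
      Tendsto (fun σ : ℝ≥0 =>
        X.nrm ((supLevel (fun x => (h x : EReal)) σ).indicator (fun _ => ((σ : ℝ) : EReal))))
        atTop (𝓝 0) ∨
      X.Mem (fun x => (h x : EReal))) :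
    ∃ (v : ℝ → P → ℝ) (E : ℝ → Set P),
      (∀ ε : ℝ, 0 < ε →
        (∃ K : ℝ≥0, LipschitzWith K (v ε)) ∧
        MemNewton X (fun x => (v ε x : EReal)) ∧
        newtonNorm X (fun x => u x - (v ε x : EReal)) < ENNReal.ofReal ε ∧
        NullMeasurableSet (E ε) μ ∧
        ∀ x ∉ E ε, u x = (v ε x : EReal)) ∧
      μ (⋂ ε ∈ Ioi (0 : ℝ), E ε) = 0 ∧
      (((∃ σ : ℝ≥0, 0 < σ ∧ μ (supLevel (fun x => (h x : EReal)) σ) < ⊤ ∧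
            μ (supLevel u σ) < ⊤) ∨
          (∃ q : ℝ, 0 < q ∧ MemLqFin μ q u ∧ MemLqFin μ q (fun x => (h x : EReal))) ∨
          (∃ q : ℝ, 0 < q ∧ ∀ f : P → EReal, X.Mem f → MemLqFin μ q f)) →
        ∀ ε : ℝ, 0 < ε → μ (E ε) < ENNReal.ofReal ε) := by
  obtain ⟨hhm, E₀, hE₀, hhaj⟩ := hh
  set h' := hhm.mk h
  set f : P → ℝ≥0∞ := fun x => (hu.1.mk u x).abs
  have hh' : Measurable h' := hhm.measurable_mk
  have hf : Measurable f := EReal.measurable_abs.comp hu.1.measurable_mk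
  have haeh : h =ᵐ[μ] h' := hhm.ae_eq_mk
  have haeu : ∀ᵐ x ∂μ, (u x).abs = f x := by
    filter_upwards [hu.1.ae_eq_mk] with x hx
    simp only [f, ← hx]
  -- A Borel null hull keeps the sets `A n` Borel, as the upper gradients built from them require;
  -- off it, the Hajłasz inequality and the Borel versions are exact.
  set N := toMeasurable μ (E₀ ∪ ({x | h x ≠ h' x} ∪ {x | (u x).abs ≠ f x}))
  have hN : MeasurableSet N := measurableSet_toMeasurable _ _
  have hN0 : μ N = 0 := by
    rw [measure_toMeasurable]
    exact measure_union_null hE₀ (measure_union_null (ae_iff.1 haeh) (ae_iff.1 haeu))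
  have hNsub : ∀ x ∉ N, x ∉ E₀ ∧ h x = h' x ∧ (u x).abs = f x := by
    intro x hx
    have := notMem_subset (subset_toMeasurable _ _) hx
    simpa only [mem_union, mem_ofPred_eq, not_or, not_not] using this
  have hNae : ∀ᵐ x ∂μ, x ∉ N := measure_eq_zero_iff_ae_notMem.1 hN0
  have hweak' : Tendsto (fun n : ℕ =>
      X.enrm ({x | (n : ℝ≥0∞) < h' x}.indicator fun _ => (n : ℝ≥0∞))) atTop (𝓝 0) := by
    rcases hweak with hw | hw
    · refine tendsto_of_tendsto_of_tendsto_of_le_of_le tendsto_const_nhds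
        (hw.comp (tendsto_natCast_atTop_atTop (R := ℝ≥0))) (fun _ => zero_le) fun n => ?_
      refine X.nrm_mono _ _ (measurable_const.indicator
        (measurableSet_lt measurable_const hh')).coe_ereal_ennreal.aemeasurable
        (aemeasurable_const.indicator₀ ?_) ?_
      · simp only [supLevel, EReal.abs_coe_ennreal]
        exact nullMeasurableSet_lt aemeasurable_const hhm
      · filter_upwards [haeh] with x hx
        by_cases hxn : (n : ℝ≥0∞) < h' x
        · simp [indicator, supLevel, hx, hxn, -EReal.coe_natCast, EReal.abs_def]
        · simp [indicator, hxn]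
    · refine hX.tendsto_enrm_superlevel hh' (lt_of_le_of_lt ?_ hw.2)
      exact QBFL.enrm_mono hh'.aemeasurable hhm (haeh.symm.mono fun x hx => hx.le)
  have hufin : X.enrm f < ⊤ := by
    refine lt_of_le_of_lt ?_ (QBFL.nrm_eq_enrm_abs hu.1 ▸ (ENNReal.add_lt_top.1 hu.2).1)
    exact QBFL.enrm_mono hf.aemeasurable (EReal.measurable_abs.comp_aemeasurable hu.1)
      (haeu.mono fun x hx => hx.ge)
  set A : ℕ → Set P := fun n => N ∪ {x | (n : ℝ≥0∞) < h' x} ∪ {x | (n : ℝ≥0∞) < f x}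
  have hmem : ∀ n x, x ∈ A n ↔ (x ∈ N ∨ (n : ℝ≥0∞) < h' x) ∨ (n : ℝ≥0∞) < f x :=
    fun n x => Iff.rfl
  have hAm : ∀ n, MeasurableSet (A n) := fun n =>
    (hN.union (measurableSet_lt measurable_const hh')).union (measurableSet_lt measurable_const hf)
  have hAanti : Antitone A := by
    intro m n hmn x hx
    have hc : (m : ℝ≥0∞) ≤ n := Nat.cast_le.2 hmn
    rw [hmem] at hx ⊢
    exact hx.imp (Or.imp_right hc.trans_lt) hc.trans_lt
  have hA0 : μ (⋂ n, A n) = 0 := by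
    rw [measure_eq_zero_iff_ae_notMem]
    filter_upwards [hNae, QBFL.ae_lt_top_of_tendsto_enrm hh' hweak',
      QBFL.ae_lt_top_of_enrm_ne_top hf hufin.ne] with x hx1 hx2 hx3 hx
    obtain ⟨n, hn⟩ := ENNReal.exists_nat_gt (max_lt hx2 hx3).ne
    rcases (hmem n x).1 (mem_iInter.1 hx n) with (h1 | h1) | h1
    · exact hx1 h1
    · exact lt_asymm h1 ((le_max_left _ _).trans_lt hn)
    · exact lt_asymm h1 ((le_max_right _ _).trans_lt hn)
  obtain ⟨v, hvlip, hvA, hvlim⟩ := exists_lipschitz_tendsto_newtonNorm hX hu hh' hf hN hN0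
    (fun x hx y hy => hhaj x (hNsub x hx).1 y (hNsub y hy).1)
    (fun x hx => (hNsub x hx).2.1) (fun x hx => (hNsub x hx).2.2) (fun n => rfl) hA0 hweak'
  have hsmall : (((∃ σ : ℝ≥0, 0 < σ ∧ μ (supLevel (fun x => (h x : EReal)) σ) < ⊤ ∧
            μ (supLevel u σ) < ⊤) ∨
          (∃ q : ℝ, 0 < q ∧ MemLqFin μ q u ∧ MemLqFin μ q (fun x => (h x : EReal))) ∨
          (∃ q : ℝ, 0 < q ∧ ∀ f : P → EReal, X.Mem f → MemLqFin μ q f)) →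
        Tendsto (fun n => μ (A n)) atTop (𝓝 0)) := by
    intro hcase
    have hLq : ∀ {q : ℝ}, 0 < q → MemLqFin μ q u → ∃ σ : ℝ≥0, μ {x | (σ : ℝ≥0∞) < f x} < ⊤ := by
      intro q hq hm
      refine hna.exists_measure_superlevel_lt_top hball hf hq fun E hE hE' => ?_
      refine lt_of_le_of_lt (lintegral_mono_ae ?_) (hm.2 E hE.nullMeasurableSet hE')
      filter_upwards [ae_restrict_of_ae haeu] with x hx
      rw [hx]
    have hfin : (∃ σ : ℝ≥0, μ {x | (σ : ℝ≥0∞) < h' x} < ⊤) ∧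
        ∃ σ : ℝ≥0, μ {x | (σ : ℝ≥0∞) < f x} < ⊤ := by
      rcases hcase with ⟨σ, -, h1, h2⟩ | ⟨q, hq, h1, h2⟩ | ⟨q, hq, hXq⟩
      · refine ⟨⟨σ, (measure_mono_ae ?_).trans_lt h1⟩, ⟨σ, (measure_mono_ae ?_).trans_lt h2⟩⟩
        · filter_upwards [haeh] with x hx (hlt : (σ : ℝ≥0∞) < h' x)
          change (σ : ℝ≥0∞) < (h x : EReal).abs
          rwa [EReal.abs_coe_ennreal, hx]
        · filter_upwards [haeu] with x hx (hlt : (σ : ℝ≥0∞) < f x)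
          change (σ : ℝ≥0∞) < (u x).abs
          rwa [hx]
      · refine ⟨hna.exists_measure_superlevel_lt_top hball hh' hq fun E hE hE' => ?_, hLq hq h1⟩
        refine lt_of_le_of_lt (lintegral_mono_ae ?_) (h2.2 E hE.nullMeasurableSet hE')
        filter_upwards [ae_restrict_of_ae haeh] with x hx
        rw [EReal.abs_coe_ennreal, hx]
      · exact ⟨exists_measure_superlevel_lt_top_of_tendsto_enrm hna hball hh' hweak' hq hXq,
          hLq hq (hXq u ⟨hu.1, (ENNReal.add_lt_top.1 hu.2).1⟩)⟩
    obtain ⟨⟨σ₁, h1⟩, ⟨σ₂, h2⟩⟩ := hfin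
    obtain ⟨n, hn⟩ := exists_nat_gt (max σ₁ σ₂)
    have hn1 : (σ₁ : ℝ≥0∞) ≤ n := by exact_mod_cast ((le_max_left _ _).trans_lt hn).le
    have hn2 : (σ₂ : ℝ≥0∞) ≤ n := by exact_mod_cast ((le_max_right _ _).trans_lt hn).le
    have hAn : μ (A n) ≠ ⊤ := by
      refine ((measure_union_le _ _).trans_lt (ENNReal.add_lt_top.2 ⟨(measure_union_le _ _).trans_lt
        (ENNReal.add_lt_top.2 ⟨by simp [hN0], ?_⟩), ?_⟩)).ne
      · exact (measure_mono fun x (hx : (n : ℝ≥0∞) < h' x) => hn1.trans_lt hx).trans_lt h1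
      · exact (measure_mono fun x (hx : (n : ℝ≥0∞) < f x) => hn2.trans_lt hx).trans_lt h2
    have := tendsto_measure_iInter_atTop (fun n => (hAm n).nullMeasurableSet) hAanti ⟨n, hAn⟩
    rwa [hA0] at this
  -- The requirement `ε⁻¹ ≤ n` forces the index to infinity as `ε → 0`, so that the intersection of
  -- the exceptional sets lies in `⋂ n, A n` even when their measures are infinite.
  have hchoice : ∀ ε : ℝ, ∃ n : ℕ, 0 < ε → ε⁻¹ ≤ n ∧
      newtonNorm X (fun x => u x - (v n x : EReal)) < ENNReal.ofReal ε ∧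
      ((((∃ σ : ℝ≥0, 0 < σ ∧ μ (supLevel (fun x => (h x : EReal)) σ) < ⊤ ∧
            μ (supLevel u σ) < ⊤) ∨
          (∃ q : ℝ, 0 < q ∧ MemLqFin μ q u ∧ MemLqFin μ q (fun x => (h x : EReal))) ∨
          (∃ q : ℝ, 0 < q ∧ ∀ f : P → EReal, X.Mem f → MemLqFin μ q f)) →
        μ (A n) < ENNReal.ofReal ε)) := by
    intro ε
    by_cases hε : 0 < ε
    · have hε' := ENNReal.ofReal_pos.2 hε
      have e1 := hvlim.eventually_lt_const hε'
      have e2 := (tendsto_natCast_atTop_atTop (R := ℝ)).eventually_ge_atTop ε⁻¹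
      -- The finiteness alternative does not involve the index, so one choice serves whether or not
      -- it holds.
      have e3 := eventually_imp_distrib_left.2 fun hc => (hsmall hc).eventually_lt_const hε'
      obtain ⟨n, h1, h2, h3⟩ := (e1.and (e2.and e3)).exists
      exact ⟨n, fun _ => ⟨h2, h1, h3⟩⟩
    · exact ⟨0, fun hc => absurd hc hε⟩
  choose n hn using hchoice
  refine ⟨fun ε => v (n ε), fun ε => A (n ε), fun ε hε => ⟨hvlip _, ?_, (hn ε hε).2.1,
    (hAm _).nullMeasurableSet, hvA _⟩, ?_, fun hc ε hε => (hn ε hε).2.2 hc⟩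
  · obtain ⟨K, hK⟩ := hvlip (n ε)
    exact hu.of_sub hK.continuous.measurable.aemeasurable
      ((hn ε hε).2.1.trans ENNReal.ofReal_lt_top)
  · refine measure_mono_null (fun x hx => mem_iInter.2 fun m => ?_) hA0
    have hm : (0 : ℝ) < ((m : ℝ) + 1)⁻¹ := by positivity
    have h1 := (hn _ hm).1
    rw [inv_inv] at h1
    refine hAanti ?_ (mem_iInter₂.1 hx _ hm)
    have : (m : ℝ) ≤ n ((m : ℝ) + 1)⁻¹ := by linarith
    exact_mod_cast this
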